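/- Let $\alpha,\beta,\gamma,\omega\in\mathbb{R}$ satisfy $\omega<0$, $0<\alpha\le 1$, $0<\alpha\gamma\le\beta\le 1$. With principal values of the complex powers (and $0^0=1$), put \[ F(s)=s^{\beta-\alpha\gamma}(s^\alpha-\omega)^\gamma ,\qquad S=\{\lambda\in\mathbb{C} : F(s)\neq\lambda \text{ for all } s\in\mathbb{C} \text{ with } \operatorname{Re}s\ge 0\}. \] For $\theta\in[0,\frac{\alpha\pi}{2})$ let \[ \Lambda(\theta)=|\omega|^{\beta/\alpha}\,\frac{(\sin\theta)^{\beta/\alpha-\gamma}\,(\sin\frac{\alpha\pi}{2})^{\gamma}}{(\sin(\frac{\alpha\pi}{2}-\theta))^{\beta/\alpha}}\; e^{i[\gamma\theta+(\beta-\alpha\gamma)\frac{\pi}{2}]}, \] and let $\Psi=\{\Lambda(\theta):0\le\theta<\frac{\alpha\pi}{2}\}$ and $\overline{\Psi}=\{\overline{z}:z\in\Psi\}$. (1) The stability region $S$ is the region of the complex plane which includes $\{\operatorname{Re}\lambda<0\}$ and is bounded by $\Psi$ and $\overline{\Psi}$. That is, $S$ is open and connected, contains the open left half-plane, has boundary $\partial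 S=\Psi\cup\overline{\Psi}$, and is the connected component of $\mathbb{C}\setminus(\Psi\cup\overline{\Psi})$ containing the open left half-plane. (2) The remaining set $D_+=\mathbb{C}\setminus(S\cup\Psi\cup\overline{\Psi})$ is open and connected with $\partial D_+=\Psi\cup\overline{\Psi}$, and for every $\lambda\in D_+$ the equation $F(s)=\lambda$ has a root with $\operatorname{Re}s>0$. (3) (Transversality.) Let $\theta\in(0,\frac{\alpha\pi}{2})$. Then $\Lambda$ is differentiable at $\theta$ with $\Lambda'(\theta)\ne0$. Put $\lambda^\star=\Lambda(\theta)$ and $n=-i\Lambda'(\theta)$, the right-pointing normal of $\Psi$. The equation $F(s)=\lambda^\star$ has exactly one root $s^\star$ on the imaginary axis, and there is a function $s(\lambda)$, holomorphic near $\lambda^\star$, with $s(\lambda^\star)=s^\star$, such that for $(\lambda,z)$ near $(\lambda^\star,s^\star)$ one has $F(z)=\lambda$ if and only if $z=s(\lambda)$. The gradient at $\lambda^\star$ of $\lambda\mapsto\operatorname{Re}s(\lambda)$, in $\mathbb{C}=\mathbb{R}^2$, is a positive multiple of $n$. For all $\lambda$ near $\lambda^\star$, $\lambda\in S$ if and only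 if $\operatorname{Re}s(\lambda)<0$, and $\lambda\in D_+$ if and only if $\operatorname{Re}s(\lambda)>0$. The same assertions hold at $\lambda^\star=\overline{\Lambda(\theta)}$ with $n=i\,\overline{\Lambda'(\theta)}$. Thus, as $\lambda$ crosses either curve from $S$ into $D_+$, a root crosses the imaginary axis from the left into the right half-plane. -/

import Mathlib

open Set Filter Topology
open scoped ComplexConjugate

noncomputable section

namespace Prabhakar

/-- The left-hand side `s^(β-αγ) (s^α - ω)^γ` of the characteristic equation, with principal
values of the complex powers. -/
def charLHS (α β γ ω : ℝ) (s : ℂ) : ℂ :=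
  s ^ ((β - α * γ : ℝ) : ℂ) * (s ^ (α : ℂ) - (ω : ℂ)) ^ (γ : ℂ)

/-- The stability region: all `z` such that `s^(β-αγ) (s^α - ω)^γ = z` has no root in the closed
right half-plane. -/
def stabilityRegion (α β γ ω : ℝ) : Set ℂ :=
  {z | ∀ s : ℂ, 0 ≤ s.re → charLHS α β γ ω s ≠ z}

/-- The parametrization `Λ` of the boundary curve (used for `0 ≤ θ < απ/2`, where all the bases of
the real powers are nonnegative). -/
def Lam (α β γ ω : ℝ) (θ : ℝ) : ℂ :=
  ((|ω| ^ (β / α) *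
      (Real.sin θ ^ (β / α - γ) * Real.sin (α * Real.pi / 2) ^ γ /
        Real.sin (α * Real.pi / 2 - θ) ^ (β / α)) : ℝ) : ℂ) *
    Complex.exp (Complex.I * ((γ * θ + (β - α * γ) * (Real.pi / 2) : ℝ) : ℂ))

/-- The curve `Ψ = {Λ(θ) : 0 ≤ θ < απ/2}`. -/
def curve (α β γ ω : ℝ) : Set ℂ :=
  Lam α β γ ω '' Ico 0 (α * Real.pi / 2)

/-- The complex conjugate of the curve `Ψ`. -/
def conjCurve (α β γ ω : ℝ) : Set ℂ :=
  {z | conj z ∈ curve α β γ ω}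

/-- The region on the other side of the two curves: all points that are neither in the stability
region nor on one of the curves. -/
def outerRegion (α β γ ω : ℝ) : Set ℂ :=
  (stabilityRegion α β γ ω ∪ (curve α β γ ω ∪ conjCurve α β γ ω))ᶜ

/-- Transversality at a point `z₀` of one of the curves, with normal direction `n`: the
characteristic equation for `z₀` has exactly one root `s₀` on the imaginary axis; near `(z₀, s₀)`
the roots form the graph of a function `s` which is holomorphic near `z₀`; the gradient of
`z ↦ Re s(z)` at `z₀` (with respect to the Euclidean structure of `ℂ = ℝ²`) is a positive multiple
of `n`; and for `z` near `z₀` the root `s(z)` lies in the open left half-plane exactly when `z` is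
in the stability region, and in the open right half-plane exactly when `z` is in the outer
region. -/
def TransversalAt (α β γ ω : ℝ) (z₀ n : ℂ) : Prop :=
  ∃ s₀ : ℂ, (∀ s : ℂ, (s.re = 0 ∧ charLHS α β γ ω s = z₀) ↔ s = s₀) ∧
    ∃ s : ℂ → ℂ, s z₀ = s₀ ∧ AnalyticAt ℂ s z₀ ∧
      (∀ᶠ p : ℂ × ℂ in 𝓝 (z₀, s₀), charLHS α β γ ω p.2 = p.1 ↔ p.2 = s p.1) ∧
      (∃ c : ℝ, 0 < c ∧ HasGradientAt (fun z : ℂ => (s z).re) ((c : ℂ) * n) z₀) ∧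
      ∀ᶠ z in 𝓝 z₀,
        (z ∈ stabilityRegion α β γ ω ↔ (s z).re < 0) ∧
        (z ∈ outerRegion α β γ ω ↔ 0 < (s z).re)

end Prabhakar

end

/-!
Write `F = charLHS α β γ ω` and `H` for the closed right half-plane, and let `w = -ω > 0` and
`a = β - α γ ≥ 0`.

**Univalence.** In the coordinate `ζ = log s`, the half-plane without `0` becomes the convex strip
`|Im ζ| ≤ π / 2`, and `F = exp ∘ G` with `G(ζ) = a ζ + γ log (exp (α ζ) + w)`. As
`G'(ζ) = a + α γ u / (u + w)` for `u = exp (α ζ)`, which has `Re u ≥ 0`, the real part of `G'` is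
positive, so `G` is injective (`injOn_of_deriv_re_pos`). Moreover `|Im G| ≤ β π / 2 ≤ π / 2`, so
`exp` is injective on the values of `G`. Hence `F` is injective on `H` (`charLHS_injOn`), has
nonzero derivative away from `0`, and takes values of nonnegative real part. Since
`‖F(s)‖ ≥ ‖s‖ ^ β`, it is a closed embedding of `H` (`isClosedEmbedding_charLHS`). So the stability
region, the complement of `F(H)`, is open. The curves are `F(iℝ)` (`image_axis_eq`), and the outer
region is therefore the image of the open half-plane, which is open and connected.

**The regions.** Along `Λ` the modulus and the argument increase and the argument stays in
`[0, π / 2]`, so `Im Λ` increases strictly; it runs through `[0, ∞)`. Together the two curves thus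
meet each horizontal line exactly once (`exists_mem_curves_im_eq`, `eq_of_mem_curves`), and the
plane is the disjoint union of the curves, their translates to the left and their translates to
the right. Both families of translates are connected and avoid the curves, while the stability
region and the outer region form a partition of the complement of the curves into open sets. Hence
the left part is the stability region and the right part is the outer region
(`stabilityRegion_eq_leftShift`, `rightShift_subset`). Connectedness and the boundaries can be read
off from this.

**Transversality.** At a point `s₀ ≠ 0` of the imaginary axis, `F` has a holomorphic local inverse
with derivative `1 / F'(s₀)`. The gradient of its real part is the conjugate of this number, which
is a positive multiple of `F'(s₀)`. As `Λ(θ) = F(i t(θ))` with `t' > 0` (`charLHS_axisHeight`,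
`exists_hasDerivAt_axisHeight`), so is the normal `-i Λ'(θ) = t'(θ) F'(s₀)`. Because `F` embeds `H`,
a point near `F(s₀)` has no root in `H` other than the value of the local inverse, so the sign of
the real part of that value decides in which region the point lies (`transversalAt_of_axis`).
-/

namespace Prabhakar

/-! ### The characteristic function in logarithmic coordinates -/

/-- The standing assumptions on the parameters; as `α > 0`, the condition `0 < α γ` amounts to
`0 < γ`. -/
structure Admissible (α β γ ω : ℝ) : Prop where
  ω_neg : ω < 0
  α_pos : 0 < α
  α_le : α ≤ 1
  γ_pos : 0 < γ
  le_β : α * γ ≤ β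
  β_le : β ≤ 1

/-- A branch of `log F(s)`, where `F = charLHS α β γ ω`, as a function of `ζ = log s`. -/
noncomputable def logLHS (α β γ ω : ℝ) (ζ : ℂ) : ℂ :=
  ((β - α * γ : ℝ) : ℂ) * ζ + (γ : ℂ) * Complex.log (Complex.exp (α * ζ) - ω)

variable {α β γ ω θ : ℝ}

lemma Admissible.β_pos (h : Admissible α β γ ω) : 0 < β :=
  (mul_pos h.α_pos h.γ_pos).trans_le h.le_β

lemma Admissible.angle_pos (h : Admissible α β γ ω) : 0 < α * Real.pi / 2 := by
  have := h.α_pos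
  positivity

lemma Admissible.angle_le (h : Admissible α β γ ω) : α * Real.pi / 2 ≤ Real.pi / 2 := by
  have := mul_le_mul_of_nonneg_right h.α_le Real.pi_pos.le
  linarith

lemma exp_mul_re_nonneg (hα : 0 < α) (hα1 : α ≤ 1) {ζ : ℂ} (hζ : |ζ.im| ≤ Real.pi / 2) :
    0 ≤ (Complex.exp (α * ζ)).re := by
  have h1 : |(α * ζ : ℂ).im| ≤ Real.pi / 2 := by
    rw [Complex.im_ofReal_mul, abs_mul, abs_of_pos hα]
    nlinarith [abs_nonneg ζ.im]
  rw [Complex.exp_re]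
  exact mul_nonneg (Real.exp_pos _).le (Real.cos_nonneg_of_mem_Icc (abs_le.1 h1))

lemma abs_im_log_le {s : ℂ} (hs : 0 ≤ s.re) : |(Complex.log s).im| ≤ Real.pi / 2 := by
  rw [Complex.log_im]
  exact Complex.abs_arg_le_pi_div_two_iff.2 hs

lemma cpow_re_nonneg {s : ℂ} (hs : 0 ≤ s.re) (hα : 0 < α) (hα1 : α ≤ 1) :
    0 ≤ (s ^ (α : ℂ)).re := by
  rcases eq_or_ne s 0 with rfl | h0
  · rw [Complex.zero_cpow (by exact_mod_cast hα.ne')]; simp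
  rw [Complex.cpow_def_of_ne_zero h0, mul_comm]
  exact exp_mul_re_nonneg hα hα1 (abs_im_log_le hs)

lemma sub_mem_slitPlane (h : Admissible α β γ ω) {u : ℂ} (hu : 0 ≤ u.re) :
    u - (ω : ℂ) ∈ Complex.slitPlane := by
  left
  have := h.ω_neg
  simp only [Complex.sub_re, Complex.ofReal_re]
  linarith

lemma norm_lt_norm_sub (hω : ω < 0) {u : ℂ} (hu : 0 ≤ u.re) : ‖u‖ < ‖u - (ω : ℂ)‖ := by
  rw [← abs_norm u, ← abs_norm (u - _), ← sq_lt_sq, ← Complex.normSq_eq_norm_sq,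
    ← Complex.normSq_eq_norm_sq, Complex.normSq_apply, Complex.normSq_apply]
  simp only [Complex.sub_re, Complex.ofReal_re, Complex.sub_im, Complex.ofReal_im]
  nlinarith

/-- Adding a positive real number to a point of the right half-plane decreases the modulus of its
argument. -/
lemma abs_arg_sub_le {u : ℂ} (hu : 0 ≤ u.re) (hω : ω < 0) :
    |(u - (ω : ℂ)).arg| ≤ |u.arg| := by
  have h1 : 0 ≤ (u - (ω : ℂ)).re := by
    simp only [Complex.sub_re, Complex.ofReal_re]; linarith
  have habs : ∀ x : ℝ, |Real.arcsin x| = Real.arcsin |x| := by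
    intro x
    rcases le_total 0 x with hx | hx
    · rw [abs_of_nonneg hx, abs_of_nonneg (Real.arcsin_nonneg.2 hx)]
    · rw [abs_of_nonpos hx, abs_of_nonpos (Real.arcsin_nonpos.2 hx), Real.arcsin_neg]
  rw [Complex.arg_of_re_nonneg h1, Complex.arg_of_re_nonneg hu, habs, habs, abs_div, abs_div,
    abs_norm, abs_norm]
  apply Real.monotone_arcsin
  rcases eq_or_ne u 0 with rfl | h0
  · simp
  have h3 : (u - (ω : ℂ)).im = u.im := by simp
  rw [h3]
  exact div_le_div_of_nonneg_left (abs_nonneg _) (norm_pos_iff.2 h0) (norm_lt_norm_sub hω hu).le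

lemma charLHS_eq_exp {s : ℂ} (hs : s ≠ 0) (hu : s ^ (α : ℂ) - (ω : ℂ) ≠ 0) :
    charLHS α β γ ω s = Complex.exp (logLHS α β γ ω (Complex.log s)) := by
  have hu' := hu
  rw [Complex.cpow_def_of_ne_zero hs] at hu'
  rw [charLHS, logLHS, Complex.cpow_def_of_ne_zero hu, Complex.cpow_def_of_ne_zero hs,
    Complex.cpow_def_of_ne_zero hs, ← Complex.exp_add]
  ring_nf

lemma cpow_sub_mem_slitPlane (h : Admissible α β γ ω) {s : ℂ} (hs : 0 ≤ s.re) :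
    s ^ (α : ℂ) - (ω : ℂ) ∈ Complex.slitPlane :=
  sub_mem_slitPlane h (cpow_re_nonneg hs h.α_pos h.α_le)

lemma charLHS_eq_exp_of_re_nonneg (h : Admissible α β γ ω) {s : ℂ} (hs : 0 ≤ s.re)
    (h0 : s ≠ 0) :
    charLHS α β γ ω s = Complex.exp (logLHS α β γ ω (Complex.log s)) :=
  charLHS_eq_exp h0 (Complex.slitPlane_ne_zero (cpow_sub_mem_slitPlane h hs))

lemma charLHS_ne_zero (h : Admissible α β γ ω) {s : ℂ} (hs : 0 ≤ s.re) (h0 : s ≠ 0) :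
    charLHS α β γ ω s ≠ 0 := by
  rw [charLHS_eq_exp_of_re_nonneg h hs h0]
  exact Complex.exp_ne_zero _

lemma abs_im_logLHS_le (h : Admissible α β γ ω) {ζ : ℂ} (hζ : |ζ.im| ≤ Real.pi / 2) :
    |(logLHS α β γ ω ζ).im| ≤ Real.pi / 2 := by
  have harg : |(Complex.exp (α * ζ) - (ω : ℂ)).arg| ≤ α * |ζ.im| := by
    refine (abs_arg_sub_le (exp_mul_re_nonneg h.α_pos h.α_le hζ) h.ω_neg).trans ?_
    have h1 : |((α : ℂ) * ζ).im| ≤ Real.pi / 2 := by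
      rw [Complex.im_ofReal_mul, abs_mul, abs_of_pos h.α_pos]
      nlinarith [abs_nonneg ζ.im, h.α_le]
    have h2 := abs_le.1 h1
    have hpi := Real.pi_pos
    have h3 := congrArg Complex.im
      (Complex.log_exp (x := α * ζ) (by linarith) (by linarith))
    rw [Complex.log_im] at h3
    rw [h3, Complex.im_ofReal_mul, abs_mul, abs_of_pos h.α_pos]
  have ha : 0 ≤ β - α * γ := sub_nonneg.2 h.le_β
  rw [logLHS, Complex.add_im, Complex.im_ofReal_mul, Complex.im_ofReal_mul, Complex.log_im]
  refine (abs_add_le _ _).trans ?_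
  rw [abs_mul, abs_mul, abs_of_nonneg ha, abs_of_pos h.γ_pos]
  have h3 := mul_le_mul_of_nonneg_left harg h.γ_pos.le
  have h4 : (β - α * γ) * |ζ.im| + γ * (α * |ζ.im|) = β * |ζ.im| := by ring
  nlinarith [abs_nonneg ζ.im, h.β_le, h.β_pos]

/-- The derivative `a + α γ u / (u - ω)`, `u = exp (α ζ)`, of `logLHS` has positive real part on
the strip, since `u / (u - ω)` has positive real part for `Re u ≥ 0`, `u ≠ 0`. -/
lemma exists_hasDerivAt_logLHS (h : Admissible α β γ ω) {ζ : ℂ} (hζ : |ζ.im| ≤ Real.pi / 2) :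
    ∃ d : ℂ, 0 < d.re ∧ HasDerivAt (logLHS α β γ ω) d ζ := by
  set u := Complex.exp (α * ζ) with hu
  have hur : 0 ≤ u.re := exp_mul_re_nonneg h.α_pos h.α_le hζ
  have hslit := sub_mem_slitPlane h hur
  have hexp : HasDerivAt (fun ζ : ℂ => Complex.exp (α * ζ) - (ω : ℂ)) (u * α) ζ := by
    simpa using (((hasDerivAt_id ζ).const_mul (α : ℂ)).cexp).sub_const (ω : ℂ)
  refine ⟨((β - α * γ : ℝ) : ℂ) + (γ : ℂ) * (u * α / (u - ω)), ?_, ?_⟩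
  · have h1 : (γ : ℂ) * (u * α / (u - ω)) = ((α * γ : ℝ) : ℂ) * (u / (u - ω)) := by
      push_cast; ring
    rw [h1, Complex.add_re, Complex.ofReal_re, Complex.re_ofReal_mul]
    have h2 : 0 < (u / (u - ω)).re := by
      rw [Complex.div_re, ← add_div]
      refine div_pos ?_ (Complex.normSq_pos.2 (Complex.slitPlane_ne_zero hslit))
      have h3 : 0 < Complex.normSq u := Complex.normSq_pos.2 (Complex.exp_ne_zero _)
      rw [Complex.normSq_apply] at h3
      simp only [Complex.sub_re, Complex.ofReal_re, Complex.sub_im, Complex.ofReal_im]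
      nlinarith [h.ω_neg]
    have := mul_pos (mul_pos h.α_pos h.γ_pos) h2
    linarith [h.le_β]
  · have h1 := (hasDerivAt_id ζ).const_mul ((β - α * γ : ℝ) : ℂ)
    rw [mul_one] at h1
    exact h1.add ((hexp.clog hslit).const_mul (γ : ℂ))

/-- A function whose derivative has positive real part on a convex set is injective there
(Noshiro–Warschawski). -/
lemma injOn_of_deriv_re_pos {f : ℂ → ℂ} {K : Set ℂ} (hK : Convex ℝ K)
    (hf : ∀ z ∈ K, ∃ d : ℂ, 0 < d.re ∧ HasDerivAt f d z) : InjOn f K := by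
  intro x hx y hy hxy
  by_contra hne
  choose! f' hpos hder using hf
  set v := y - x with hv
  have hv0 : v ≠ 0 := sub_ne_zero.2 (Ne.symm hne)
  have hmem : ∀ t ∈ Icc (0 : ℝ) 1, x + (t : ℂ) * v ∈ K := by
    intro t ht
    have := hK.add_smul_sub_mem hx hy ht
    simpa using this
  have hline : ∀ t : ℝ, HasDerivAt (fun t : ℝ => x + (t : ℂ) * v) v t := by
    intro t
    simpa using ((Complex.ofRealCLM.hasDerivAt (x := t)).mul_const v).const_add x
  have hd : ∀ t ∈ Icc (0 : ℝ) 1, HasDerivAt (fun t : ℝ => (conj v * f (x + (t : ℂ) * v)).re)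
      (conj v * (f' (x + (t : ℂ) * v) * v)).re t := by
    intro t ht
    have h1 := ((hder _ (hmem t ht)).comp_of_eq t (hline t) rfl).const_mul (conj v)
    exact Complex.reCLM.hasFDerivAt.comp_hasDerivAt t h1
  -- along the segment from `x` to `y = x + v`, the derivative of `Re (conj v * f)` is
  -- `|v| ^ 2 * Re f'`
  have hmono : StrictMonoOn (fun t : ℝ => (conj v * f (x + (t : ℂ) * v)).re) (Icc 0 1) := by
    refine strictMonoOn_of_deriv_pos (convex_Icc 0 1)
      (fun t ht => (hd t ht).continuousAt.continuousWithinAt) ?_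
    intro t ht
    rw [interior_Icc] at ht
    have ht' := Ioo_subset_Icc_self ht
    rw [(hd t ht').deriv]
    have h2 : conj v * (f' (x + (t : ℂ) * v) * v) =
        ((Complex.normSq v : ℝ) : ℂ) * f' (x + (t : ℂ) * v) := by
      rw [Complex.normSq_eq_conj_mul_self]; ring
    rw [h2, Complex.re_ofReal_mul]
    exact mul_pos (Complex.normSq_pos.2 hv0) (hpos _ (hmem t ht'))
  have := hmono (left_mem_Icc.2 zero_le_one) (right_mem_Icc.2 zero_le_one) zero_lt_one
  simp [hv, hxy] at this

lemma injOn_logLHS (h : Admissible α β γ ω) :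
    InjOn (logLHS α β γ ω) {ζ : ℂ | |ζ.im| ≤ Real.pi / 2} := by
  refine injOn_of_deriv_re_pos ?_ fun ζ hζ => exists_hasDerivAt_logLHS h hζ
  have : {ζ : ℂ | |ζ.im| ≤ Real.pi / 2} = Complex.imLm ⁻¹' Icc (-(Real.pi / 2)) (Real.pi / 2) := by
    ext ζ; simp [abs_le]
  rw [this]
  exact (convex_Icc _ _).linear_preimage _

/-! ### The characteristic function on the closed right half-plane -/

lemma charLHS_re_nonneg (h : Admissible α β γ ω) {s : ℂ} (hs : 0 ≤ s.re) :
    0 ≤ (charLHS α β γ ω s).re := by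
  rcases eq_or_ne s 0 with rfl | h0
  · have hω : (0 : ℂ) ^ (α : ℂ) - (ω : ℂ) = ((-ω : ℝ) : ℂ) := by
      rw [Complex.zero_cpow (by exact_mod_cast h.α_pos.ne')]; simp
    have hω' : 0 ≤ -ω := by linarith [h.ω_neg]
    rw [charLHS, hω, ← Complex.ofReal_cpow hω', ← Complex.ofReal_zero,
      ← Complex.ofReal_cpow le_rfl, ← Complex.ofReal_mul, Complex.ofReal_re]
    exact mul_nonneg (Real.rpow_nonneg le_rfl _) (Real.rpow_nonneg hω' _)
  · rw [charLHS_eq_exp_of_re_nonneg h hs h0, Complex.exp_re]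
    exact mul_nonneg (Real.exp_pos _).le
      (Real.cos_nonneg_of_mem_Icc (abs_le.1 (abs_im_logLHS_le h (abs_im_log_le hs))))

lemma norm_charLHS (s : ℂ) : ‖charLHS α β γ ω s‖ =
    ‖s‖ ^ (β - α * γ) * ‖s ^ (α : ℂ) - (ω : ℂ)‖ ^ γ := by
  rw [charLHS, norm_mul, Complex.norm_cpow_real, Complex.norm_cpow_real]

lemma neg_lt_norm_sub (hω : ω < 0) {u : ℂ} (hu : 0 ≤ u.re) (h0 : u ≠ 0) :
    -ω < ‖u - (ω : ℂ)‖ := by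
  rw [← abs_of_pos (neg_pos.2 hω), ← abs_norm (u - _), ← sq_lt_sq, ← Complex.normSq_eq_norm_sq,
    Complex.normSq_apply]
  simp only [Complex.sub_re, Complex.ofReal_re, Complex.sub_im, Complex.ofReal_im]
  have := Complex.normSq_pos.2 h0
  rw [Complex.normSq_apply] at this
  nlinarith

/-- If `β = α γ`, then `F(0) = (-ω) ^ γ` because `0 ^ 0 = 1`, and `|F(s)| > (-ω) ^ γ` for `s ≠ 0`;
otherwise `F(0) = 0`. -/
lemma charLHS_ne_charLHS_zero (h : Admissible α β γ ω) {s : ℂ} (hs : 0 ≤ s.re) (h0 : s ≠ 0) :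
    charLHS α β γ ω s ≠ charLHS α β γ ω 0 := by
  rcases h.le_β.eq_or_lt with hβ | hβ
  · intro heq
    have hn := congrArg norm heq
    have hα0 : (α : ℂ) ≠ 0 := by exact_mod_cast h.α_pos.ne'
    rw [norm_charLHS, norm_charLHS, ← hβ, sub_self, Real.rpow_zero, Real.rpow_zero, one_mul,
      one_mul, Complex.zero_cpow hα0, zero_sub, norm_neg, Complex.norm_real, Real.norm_eq_abs,
      abs_of_neg h.ω_neg] at hn
    have hlt := neg_lt_norm_sub h.ω_neg (cpow_re_nonneg hs h.α_pos h.α_le)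
      (by rw [Complex.cpow_ne_zero_iff_of_exponent_ne_zero hα0]; exact h0)
    exact (Real.rpow_lt_rpow (by linarith [h.ω_neg]) hlt h.γ_pos).ne' hn
  · have h1 : charLHS α β γ ω 0 = 0 := by
      rw [charLHS, Complex.zero_cpow (by exact_mod_cast (sub_pos.2 hβ).ne'), zero_mul]
    rw [h1]
    exact charLHS_ne_zero h hs h0

/-- The characteristic function is univalent on the closed right half-plane. -/
lemma charLHS_injOn (h : Admissible α β γ ω) :
    InjOn (charLHS α β γ ω) {s : ℂ | 0 ≤ s.re} := by
  intro s hs t ht hst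
  rw [mem_ofPred_eq] at hs ht
  by_cases hs0 : s = 0
  · by_contra hne
    subst hs0
    exact charLHS_ne_charLHS_zero h ht (Ne.symm hne) hst.symm
  by_cases ht0 : t = 0
  · subst ht0
    exact absurd hst (charLHS_ne_charLHS_zero h hs hs0)
  rw [charLHS_eq_exp_of_re_nonneg h hs hs0, charLHS_eq_exp_of_re_nonneg h ht ht0] at hst
  have h1 := abs_le.1 (abs_im_logLHS_le h (abs_im_log_le hs))
  have h2 := abs_le.1 (abs_im_logLHS_le h (abs_im_log_le ht))
  have hpi := Real.pi_pos
  have h3 := Complex.exp_inj_of_neg_pi_lt_of_le_pi (by linarith) (by linarith) (by linarith)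
    (by linarith) hst
  have h4 := injOn_logLHS h (abs_im_log_le hs) (abs_im_log_le ht) h3
  rw [← Complex.exp_log hs0, ← Complex.exp_log ht0, h4]

lemma continuousOn_charLHS (h : Admissible α β γ ω) :
    ContinuousOn (charLHS α β γ ω) {s : ℂ | 0 ≤ s.re} := by
  intro s hs
  refine ContinuousAt.continuousWithinAt ?_
  have h1 : ContinuousAt (fun s : ℂ => s ^ (α : ℂ)) s :=
    Complex.continuousAt_cpow_const_of_re_pos (Or.inl hs) (by simpa using h.α_pos)
  have h2 : ContinuousAt (fun s : ℂ => s ^ ((β - α * γ : ℝ) : ℂ)) s := by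
    rcases (sub_nonneg.2 h.le_β).eq_or_lt with h0 | h0
    · simp only [← h0, Complex.ofReal_zero, Complex.cpow_zero]
      exact continuousAt_const
    · exact Complex.continuousAt_cpow_const_of_re_pos (Or.inl hs) (by simpa using h0)
  exact h2.mul ((h1.sub continuousAt_const).cpow continuousAt_const (cpow_sub_mem_slitPlane h hs))

lemma norm_rpow_le_norm_charLHS (h : Admissible α β γ ω) {s : ℂ} (hs : 0 ≤ s.re) :
    ‖s‖ ^ β ≤ ‖charLHS α β γ ω s‖ := by
  rw [norm_charLHS]
  have h1 := (norm_lt_norm_sub h.ω_neg (cpow_re_nonneg hs h.α_pos h.α_le)).le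
  rw [Complex.norm_cpow_real] at h1
  have h2 := Real.rpow_le_rpow (Real.rpow_nonneg (norm_nonneg _) _) h1 h.γ_pos.le
  rw [← Real.rpow_mul (norm_nonneg _)] at h2
  calc ‖s‖ ^ β = ‖s‖ ^ (β - α * γ) * ‖s‖ ^ (α * γ) := by
        rw [← Real.rpow_add_of_nonneg (norm_nonneg _) (sub_nonneg.2 h.le_β)
          (mul_pos h.α_pos h.γ_pos).le, sub_add_cancel]
    _ ≤ _ := mul_le_mul_of_nonneg_left h2 (Real.rpow_nonneg (norm_nonneg _) _)

/-- The characteristic function maps the closed right half-plane homeomorphically onto a closed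
set. -/
lemma isClosedEmbedding_charLHS (h : Admissible α β γ ω) :
    IsClosedEmbedding ({s : ℂ | 0 ≤ s.re}.domRestrict (charLHS α β γ ω)) := by
  have hcl : IsClosed {s : ℂ | 0 ≤ s.re} := isClosed_le continuous_const Complex.continuous_re
  have hc := (continuousOn_charLHS h).domRestrict
  have hprop : IsProperMap ({s : ℂ | 0 ≤ s.re}.domRestrict (charLHS α β γ ω)) := by
    refine isProperMap_iff_tendsto_cocompact.2 ⟨hc, ?_⟩
    rw [← Metric.cobounded_eq_cocompact (α := ℂ), ← tendsto_norm_atTop_iff_cobounded]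
    have h1 : Tendsto (fun s : {s : ℂ | 0 ≤ s.re} => ‖(s : ℂ)‖ ^ β)
        (cocompact {s : ℂ | 0 ≤ s.re}) atTop :=
      (tendsto_rpow_atTop h.β_pos).comp
        (tendsto_norm_cocompact_atTop.comp hcl.isClosedEmbedding_subtypeVal.tendsto_cocompact)
    exact tendsto_atTop_mono (fun s => norm_rpow_le_norm_charLHS h s.2) h1
  exact .of_continuous_injective_isClosedMap hc (charLHS_injOn h).injective hprop.isClosedMap

lemma mem_slitPlane_of_re_nonneg {s : ℂ} (hs : 0 ≤ s.re) (h0 : s ≠ 0) :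
    s ∈ Complex.slitPlane := by
  rw [Complex.mem_slitPlane_iff]
  by_contra! hcon
  exact h0 (Complex.ext (by simpa using le_antisymm hcon.1 hs) hcon.2)

lemma analyticAt_charLHS (h : Admissible α β γ ω) {s : ℂ} (hs : 0 ≤ s.re) (h0 : s ≠ 0) :
    AnalyticAt ℂ (charLHS α β γ ω) s := by
  have hslit := mem_slitPlane_of_re_nonneg hs h0
  exact (analyticAt_id.cpow analyticAt_const hslit).mul
    (((analyticAt_id.cpow analyticAt_const hslit).sub analyticAt_const).cpow analyticAt_const
      (cpow_sub_mem_slitPlane h hs))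

lemma deriv_charLHS_ne_zero (h : Admissible α β γ ω) {s : ℂ} (hs : 0 ≤ s.re) (h0 : s ≠ 0) :
    deriv (charLHS α β γ ω) s ≠ 0 := by
  have hslit := mem_slitPlane_of_re_nonneg hs h0
  obtain ⟨d, hd, hder⟩ := exists_hasDerivAt_logLHS h (abs_im_log_le hs)
  have h1 : HasDerivAt (fun s => Complex.exp (logLHS α β γ ω (Complex.log s)))
      (Complex.exp (logLHS α β γ ω (Complex.log s)) * (d * s⁻¹)) s :=
    (hder.comp s (Complex.hasDerivAt_log hslit)).cexp
  have hca : ContinuousAt (fun s : ℂ => s ^ (α : ℂ) - (ω : ℂ)) s :=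
    (continuousAt_id.cpow continuousAt_const hslit).sub continuousAt_const
  have heq : charLHS α β γ ω =ᶠ[𝓝 s]
      fun s => Complex.exp (logLHS α β γ ω (Complex.log s)) := by
    filter_upwards [isOpen_ne.mem_nhds h0, hca.eventually_ne
      (Complex.slitPlane_ne_zero (cpow_sub_mem_slitPlane h hs))] with z hz hz'
    exact charLHS_eq_exp hz hz'
  rw [heq.deriv_eq, h1.deriv]
  refine mul_ne_zero (Complex.exp_ne_zero _) (mul_ne_zero ?_ (inv_ne_zero h0))
  rintro rfl
  simp at hd

lemma charLHS_conj {s : ℂ} (hs : s.arg ≠ Real.pi)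
    (hu : (s ^ (α : ℂ) - (ω : ℂ)).arg ≠ Real.pi) :
    charLHS α β γ ω (conj s) = conj (charLHS α β γ ω s) := by
  have h1 : ∀ r : ℝ, conj s ^ (r : ℂ) = conj (s ^ (r : ℂ)) := fun r => by
    rw [Complex.conj_cpow _ _ hs, Complex.conj_ofReal]
  have h2 : conj (s ^ (α : ℂ)) - (ω : ℂ) = conj (s ^ (α : ℂ) - (ω : ℂ)) := by simp
  rw [charLHS, charLHS, h1, h1, h2, Complex.conj_cpow _ _ hu, map_mul, Complex.conj_ofReal]

lemma charLHS_conj_of_re_nonneg (h : Admissible α β γ ω) {s : ℂ} (hs : 0 ≤ s.re) :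
    charLHS α β γ ω (conj s) = conj (charLHS α β γ ω s) := by
  refine charLHS_conj (fun hcon => ?_)
    (Complex.mem_slitPlane_iff_arg.1 (cpow_sub_mem_slitPlane h hs)).1
  have := Complex.abs_arg_le_pi_div_two_iff.2 hs
  rw [hcon, abs_of_pos Real.pi_pos] at this
  linarith [Real.pi_pos]

lemma deriv_charLHS_conj (h : Admissible α β γ ω) {s : ℂ} (hs : 0 ≤ s.re) (h0 : s ≠ 0) :
    deriv (charLHS α β γ ω) (conj s) = conj (deriv (charLHS α β γ ω) s) := by
  have hslit := mem_slitPlane_of_re_nonneg hs h0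
  have hca : ContinuousAt (fun s : ℂ => s ^ (α : ℂ) - (ω : ℂ)) s :=
    (continuousAt_id.cpow continuousAt_const hslit).sub continuousAt_const
  have hev : ∀ᶠ z in 𝓝 s, charLHS α β γ ω (conj z) = conj (charLHS α β γ ω z) := by
    filter_upwards [Complex.isOpen_slitPlane.mem_nhds hslit,
      hca.preimage_mem_nhds (Complex.isOpen_slitPlane.mem_nhds (cpow_sub_mem_slitPlane h hs))]
      with z hz hz'
    exact charLHS_conj (Complex.mem_slitPlane_iff_arg.1 hz).1
      (Complex.mem_slitPlane_iff_arg.1 hz').1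
  have h1 := (analyticAt_charLHS h hs h0).differentiableAt.hasDerivAt.conj_conj
  refine (h1.congr_of_eventuallyEq ?_).deriv
  have h2 := (Complex.continuous_conj.tendsto (conj s)).eventually
    (by rwa [Complex.conj_conj] : ∀ᶠ z in 𝓝 (conj (conj s)), _)
  filter_upwards [h2] with z hz
  simpa using hz

/-! ### The boundary curves as the image of the imaginary axis -/

/-- The height `t` at which the imaginary axis has to be cut in order that
`charLHS α β γ ω (t * I) = Lam α β γ ω θ`. It is determined by `(t * I) ^ α - ω` having
argument `θ`, through the law of sines. -/
noncomputable def axisHeight (α ω θ : ℝ) : ℝ :=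
  (-ω * (Real.sin θ / Real.sin (α * Real.pi / 2 - θ))) ^ (1 / α)

lemma polar_cpow {r φ : ℝ} (hr : 0 < r) (h1 : -Real.pi < φ) (h2 : φ ≤ Real.pi) (y : ℝ) :
    ((r : ℂ) * Complex.exp (φ * Complex.I)) ^ (y : ℂ) =
      ((r ^ y : ℝ) : ℂ) * Complex.exp ((y * φ : ℝ) * Complex.I) := by
  have h3 : (r : ℂ) * Complex.exp (φ * Complex.I) =
      Complex.exp ((Real.log r : ℝ) + φ * Complex.I) := by
    rw [Complex.exp_add, ← Complex.ofReal_exp, Real.exp_log hr]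
  rw [h3, Complex.cpow_def_of_ne_zero (Complex.exp_ne_zero _),
    Complex.log_exp (by simpa using h1) (by simpa using h2), Real.rpow_def_of_pos hr,
    Complex.ofReal_exp, ← Complex.exp_add]
  push_cast
  ring_nf

lemma sin_angle_pos (h : Admissible α β γ ω) : 0 < Real.sin (α * Real.pi / 2) :=
  Real.sin_pos_of_pos_of_lt_pi h.angle_pos (by linarith [h.angle_le, Real.pi_pos])

lemma sin_sub_pos (h : Admissible α β γ ω) (hθ : θ ∈ Ico 0 (α * Real.pi / 2)) :
    0 < Real.sin (α * Real.pi / 2 - θ) :=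
  Real.sin_pos_of_pos_of_lt_pi (by linarith [hθ.2]) (by linarith [h.angle_le, Real.pi_pos, hθ.1])

lemma sin_nonneg_of_mem (h : Admissible α β γ ω) (hθ : θ ∈ Icc 0 (α * Real.pi / 2)) :
    0 ≤ Real.sin θ :=
  Real.sin_nonneg_of_nonneg_of_le_pi hθ.1 (by linarith [hθ.2, h.angle_le, Real.pi_pos])

lemma sin_pos_of_mem (h : Admissible α β γ ω) (hθ : θ ∈ Ioo 0 (α * Real.pi / 2)) :
    0 < Real.sin θ :=
  Real.sin_pos_of_pos_of_lt_pi hθ.1 (by linarith [hθ.2, h.angle_le, Real.pi_pos])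

lemma axisHeight_pos (h : Admissible α β γ ω) (hθ : θ ∈ Ioo 0 (α * Real.pi / 2)) :
    0 < axisHeight α ω θ := by
  have := sin_sub_pos h (Ioo_subset_Ico_self hθ)
  have := sin_pos_of_mem h hθ
  have := neg_pos.2 h.ω_neg
  exact Real.rpow_pos_of_pos (by positivity) _

lemma axisHeight_zero (h : Admissible α β γ ω) : axisHeight α ω 0 = 0 := by
  have : 1 / α ≠ 0 := (one_div_pos.2 h.α_pos).ne'
  simp [axisHeight, Real.zero_rpow, h.α_pos.ne']

lemma div_sub_nonneg (h : Admissible α β γ ω) : 0 ≤ β / α - γ := by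
  rw [sub_nonneg, le_div_iff₀ h.α_pos, mul_comm]
  exact h.le_β

/-- Both sides are `(-ω) ^ γ` if `β = α γ`, by the convention `0 ^ 0 = 1`, and `0` otherwise. -/
lemma charLHS_zero_eq_Lam (h : Admissible α β γ ω) : charLHS α β γ ω 0 = Lam α β γ ω 0 := by
  have hα0 : (α : ℂ) ≠ 0 := by exact_mod_cast h.α_pos.ne'
  have hα := h.α_pos.ne'
  rcases h.le_β.eq_or_lt with hβ | hβ
  · have h1 : (0 : ℂ) ^ (α : ℂ) - (ω : ℂ) = ((-ω : ℝ) : ℂ) := by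
      rw [Complex.zero_cpow hα0]; simp
    have h2 : β / α = γ := by rw [← hβ]; field_simp
    have h3 := (Real.rpow_pos_of_pos (sin_angle_pos h) γ).ne'
    rw [charLHS, h1, Lam, h2, ← hβ, ← Complex.ofReal_cpow (by linarith [h.ω_neg]),
      abs_of_neg h.ω_neg]
    simp [div_self h3]
  · have h1 : β / α - γ ≠ 0 := by
      rw [ne_eq, sub_eq_zero, div_eq_iff hα, mul_comm]
      exact hβ.ne'
    rw [charLHS, Complex.zero_cpow (by exact_mod_cast (sub_pos.2 hβ).ne'), zero_mul, Lam,
      Real.sin_zero, Real.zero_rpow h1]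
    simp

/-- The curve `Λ` parametrizes the image of the upper imaginary half-axis. -/
lemma charLHS_axisHeight (h : Admissible α β γ ω) (hθ : θ ∈ Ico 0 (α * Real.pi / 2)) :
    charLHS α β γ ω (axisHeight α ω θ * Complex.I) = Lam α β γ ω θ := by
  rcases hθ.1.eq_or_lt with h0 | h0
  · rw [← h0, axisHeight_zero h, Complex.ofReal_zero, zero_mul, charLHS_zero_eq_Lam h]
  have hθ' : θ ∈ Ioo 0 (α * Real.pi / 2) := ⟨h0, hθ.2⟩
  have hw := neg_pos.2 h.ω_neg
  have hd := sin_sub_pos h hθ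
  have hs := sin_pos_of_mem h hθ'
  have hS := sin_angle_pos h
  have hα := h.α_pos
  have hpi := Real.pi_pos
  set d := Real.sin (α * Real.pi / 2 - θ) with hd_def
  have ht := axisHeight_pos h hθ'
  have hI : Complex.I = Complex.exp ((Real.pi / 2 : ℝ) * Complex.I) := by
    push_cast; rw [Complex.exp_pi_div_two_mul_I]
  have hpow : ∀ y : ℝ, ((axisHeight α ω θ : ℂ) * Complex.I) ^ (y : ℂ) =
      (((-ω * (Real.sin θ / d)) ^ (y / α) : ℝ) : ℂ) *
        Complex.exp ((y * (Real.pi / 2) : ℝ) * Complex.I) := by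
    intro y
    conv_lhs => rw [hI]
    rw [polar_cpow ht (by linarith) (by linarith), axisHeight, ← Real.rpow_mul (by positivity),
      one_div_mul_eq_div]
  have hu : ((axisHeight α ω θ : ℂ) * Complex.I) ^ (α : ℂ) - (ω : ℂ) =
      ((-ω * (Real.sin (α * Real.pi / 2) / d) : ℝ) : ℂ) * Complex.exp (θ * Complex.I) := by
    rw [hpow α, div_self hα.ne', Real.rpow_one]
    have hda : d = Real.sin (α * (Real.pi / 2)) * Real.cos θ -
        Real.cos (α * (Real.pi / 2)) * Real.sin θ := by
      rw [hd_def, Real.sin_sub, mul_div_assoc]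
    have hψ : α * Real.pi / 2 = α * (Real.pi / 2) := by ring
    rw [hψ]
    apply Complex.ext
    · simp only [Complex.sub_re, Complex.re_ofReal_mul, Complex.exp_ofReal_mul_I_re,
        Complex.ofReal_re]
      field_simp
      rw [hda]
      ring_nf
    · simp only [Complex.sub_im, Complex.im_ofReal_mul, Complex.exp_ofReal_mul_I_im,
        Complex.ofReal_im]
      field_simp
      ring
  rw [charLHS, hu, hpow, polar_cpow (by positivity) (by linarith)
    (by linarith [hθ.2, h.angle_le]), Lam, abs_of_neg h.ω_neg]
  have hmod : (-ω * (Real.sin θ / d)) ^ ((β - α * γ) / α) *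
      (-ω * (Real.sin (α * Real.pi / 2) / d)) ^ γ = (-ω) ^ (β / α) *
        (Real.sin θ ^ (β / α - γ) * Real.sin (α * Real.pi / 2) ^ γ / d ^ (β / α)) := by
    have hp : (β - α * γ) / α = β / α - γ := by field_simp
    have hsum : ∀ x : ℝ, 0 < x → x ^ (β / α) = x ^ (β / α - γ) * x ^ γ := fun x hx => by
      rw [← Real.rpow_add hx, sub_add_cancel]
    rw [hp, Real.mul_rpow hw.le (by positivity), Real.mul_rpow hw.le (by positivity),
      Real.div_rpow hs.le hd.le, Real.div_rpow hS.le hd.le, hsum _ hw, hsum _ hd]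
    field_simp
  rw [← hmod, mul_mul_mul_comm, ← Complex.ofReal_mul, ← Complex.exp_add]
  congr 2
  push_cast
  ring_nf

lemma exists_axisHeight_eq (h : Admissible α β γ ω) {t : ℝ} (ht : 0 ≤ t) :
    ∃ θ ∈ Ico 0 (α * Real.pi / 2), axisHeight α ω θ = t := by
  have hw := neg_pos.2 h.ω_neg
  have hS := sin_angle_pos h
  have hα := h.α_pos
  -- the equation `axisHeight α ω θ = t`, raised to the power `α` and cleared of its denominator
  set f : ℝ → ℝ := fun θ => -ω * Real.sin θ - t ^ α * Real.sin (α * Real.pi / 2 - θ) with hf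
  have hcont : ContinuousOn f (Icc 0 (α * Real.pi / 2)) := by
    apply Continuous.continuousOn
    fun_prop
  have h0 : f 0 ≤ 0 := by
    simp only [hf, Real.sin_zero, sub_zero, mul_zero, zero_sub]
    have := Real.rpow_nonneg ht α
    have := mul_nonneg this hS.le
    linarith
  have h1 : 0 < f (α * Real.pi / 2) := by
    simp only [hf, sub_self, Real.sin_zero, mul_zero, sub_zero]
    exact mul_pos hw hS
  obtain ⟨θ, hθ, hθ0⟩ := intermediate_value_Icc h.angle_pos.le hcont ⟨h0, h1.le⟩
  have hne : θ ≠ α * Real.pi / 2 := by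
    rintro rfl
    exact h1.ne' hθ0
  have hθ' : θ ∈ Ico 0 (α * Real.pi / 2) := ⟨hθ.1, hθ.2.lt_of_ne hne⟩
  refine ⟨θ, hθ', ?_⟩
  have hd := sin_sub_pos h hθ'
  have h2 : -ω * (Real.sin θ / Real.sin (α * Real.pi / 2 - θ)) = t ^ α := by
    rw [← mul_div_assoc, div_eq_iff hd.ne']
    simp only [hf] at hθ0
    linarith
  rw [axisHeight, h2, ← Real.rpow_mul ht, mul_one_div_cancel hα.ne', Real.rpow_one]

lemma image_axis_eq (h : Admissible α β γ ω) : charLHS α β γ ω '' {s | s.re = 0} =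
    curve α β γ ω ∪ conjCurve α β γ ω := by
  have hre : ∀ t : ℝ, 0 ≤ ((t : ℂ) * Complex.I).re := fun t => by simp
  have hup : ∀ t : ℝ, 0 ≤ t → charLHS α β γ ω (t * Complex.I) ∈ curve α β γ ω := by
    intro t ht
    obtain ⟨θ, hθ, rfl⟩ := exists_axisHeight_eq h ht
    exact ⟨θ, hθ, (charLHS_axisHeight h hθ).symm⟩
  have hconj : ∀ t : ℝ, charLHS α β γ ω ((-t : ℝ) * Complex.I) =
      conj (charLHS α β γ ω (t * Complex.I)) := by
    intro t
    rw [← charLHS_conj_of_re_nonneg h (hre t)]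
    simp
  apply Subset.antisymm
  · rintro _ ⟨s, hs, rfl⟩
    have hs' : s = (s.im : ℂ) * Complex.I := Complex.ext (by simpa using hs) (by simp)
    rw [hs']
    rcases le_total 0 s.im with him | him
    · exact Or.inl (hup _ him)
    · right
      rw [conjCurve, mem_ofPred_eq, ← hconj]
      exact hup _ (by linarith)
  · rintro z (⟨θ, hθ, rfl⟩ | ⟨θ, hθ, hz⟩)
    · exact ⟨_, by simp, charLHS_axisHeight h hθ⟩
    · refine ⟨((-axisHeight α ω θ : ℝ) : ℂ) * Complex.I, by simp, ?_⟩
      rw [hconj, charLHS_axisHeight h hθ, hz, Complex.conj_conj]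

/-! ### The boundary curves form a graph over the imaginary axis -/

lemma Lam_im (θ : ℝ) : (Lam α β γ ω θ).im =
    |ω| ^ (β / α) * (Real.sin θ ^ (β / α - γ) * Real.sin (α * Real.pi / 2) ^ γ /
        Real.sin (α * Real.pi / 2 - θ) ^ (β / α)) *
      Real.sin (γ * θ + (β - α * γ) * (Real.pi / 2)) := by
  rw [Lam, Complex.im_ofReal_mul, mul_comm Complex.I, Complex.exp_ofReal_mul_I_im]

lemma phase_mem (h : Admissible α β γ ω) (hθ : θ ∈ Icc 0 (α * Real.pi / 2)) :
    γ * θ + (β - α * γ) * (Real.pi / 2) ∈ Icc 0 (Real.pi / 2) := by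
  have h1 := mul_nonneg h.γ_pos.le hθ.1
  have h2 := mul_le_mul_of_nonneg_left hθ.2 h.γ_pos.le
  have h3 := mul_nonneg (sub_nonneg.2 h.le_β) (half_pos Real.pi_pos).le
  have h4 := mul_le_mul_of_nonneg_right h.β_le (half_pos Real.pi_pos).le
  constructor <;> nlinarith

/-- Both the modulus and the argument of `Λ(θ)` increase with `θ`, and the argument stays in
`[0, π / 2]`. Hence so does the imaginary part. -/
lemma strictMonoOn_Lam_im (h : Admissible α β γ ω) :
    StrictMonoOn (fun θ => (Lam α β γ ω θ).im) (Ico 0 (α * Real.pi / 2)) := by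
  intro θ₁ h₁ θ₂ h₂ hlt
  have hw : 0 < |ω| := abs_pos.2 h.ω_neg.ne
  have hS := sin_angle_pos h
  have hd₁ := sin_sub_pos h h₁
  have hd₂ := sin_sub_pos h h₂
  have hs₁ := sin_nonneg_of_mem h (Ico_subset_Icc_self h₁)
  have hs₂ := sin_pos_of_mem h ⟨h₁.1.trans_lt hlt, h₂.2⟩
  have hpi := Real.pi_pos
  have hang := h.angle_le
  have hss : Real.sin θ₁ ≤ Real.sin θ₂ :=
    Real.sin_le_sin_of_le_of_le_pi_div_two (by linarith [h₁.1]) (by linarith [h₂.2]) hlt.le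
  have hdd : Real.sin (α * Real.pi / 2 - θ₂) ≤ Real.sin (α * Real.pi / 2 - θ₁) :=
    Real.sin_le_sin_of_le_of_le_pi_div_two (by linarith [h₂.2]) (by linarith [h₁.1])
      (by linarith)
  have hp₁ := phase_mem h (Ico_subset_Icc_self h₁)
  have hp₂ := phase_mem h (Ico_subset_Icc_self h₂)
  have hphase : Real.sin (γ * θ₁ + (β - α * γ) * (Real.pi / 2)) <
      Real.sin (γ * θ₂ + (β - α * γ) * (Real.pi / 2)) :=
    Real.sin_lt_sin_of_lt_of_le_pi_div_two (by linarith [hp₁.1]) hp₂.2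
      (by linarith [mul_lt_mul_of_pos_left hlt h.γ_pos])
  have hphase0 : 0 ≤ Real.sin (γ * θ₁ + (β - α * γ) * (Real.pi / 2)) :=
    Real.sin_nonneg_of_nonneg_of_le_pi hp₁.1 (by linarith [hp₁.2])
  simp only [Lam_im]
  refine mul_lt_mul_of_le_of_lt_of_nonneg_of_pos ?_ hphase hphase0 (by positivity)
  have hb : 0 ≤ β / α := (div_pos h.β_pos h.α_pos).le
  have := div_sub_nonneg h
  gcongr

lemma Lam_zero_im (h : Admissible α β γ ω) : (Lam α β γ ω 0).im = 0 := by
  rw [← charLHS_zero_eq_Lam h]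
  have := charLHS_conj_of_re_nonneg h (s := 0) le_rfl
  rw [map_zero] at this
  exact Complex.conj_eq_iff_im.1 this.symm

lemma Lam_im_nonneg (h : Admissible α β γ ω) (hθ : θ ∈ Ico 0 (α * Real.pi / 2)) :
    0 ≤ (Lam α β γ ω θ).im := by
  rw [← Lam_zero_im h]
  exact (strictMonoOn_Lam_im h).monotoneOn (left_mem_Ico.2 h.angle_pos) hθ hθ.1

lemma exists_Lam_im_eq (h : Admissible α β γ ω) {y : ℝ} (hy : 0 ≤ y) :
    ∃ θ ∈ Ico 0 (α * Real.pi / 2), (Lam α β γ ω θ).im = y := by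
  have hw : 0 < |ω| := abs_pos.2 h.ω_neg.ne
  have hS := sin_angle_pos h
  have hb : 0 < β / α := div_pos h.β_pos h.α_pos
  have hp := div_sub_nonneg h
  have hpi := Real.pi_pos
  -- the equation `Im Λ(θ) = y` after multiplication by the denominator, which vanishes at the
  -- right end point
  set f : ℝ → ℝ := fun θ => |ω| ^ (β / α) * (Real.sin θ ^ (β / α - γ) *
      Real.sin (α * Real.pi / 2) ^ γ) * Real.sin (γ * θ + (β - α * γ) * (Real.pi / 2)) -
      y * Real.sin (α * Real.pi / 2 - θ) ^ (β / α) with hf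
  have hcont : ContinuousOn f (Icc 0 (α * Real.pi / 2)) := by
    have h1 : Continuous fun θ : ℝ => Real.sin θ ^ (β / α - γ) :=
      Real.continuous_sin.rpow_const fun _ => Or.inr hp
    have h2 : Continuous fun θ : ℝ => Real.sin (α * Real.pi / 2 - θ) ^ (β / α) :=
      (Real.continuous_sin.comp (continuous_const.sub continuous_id)).rpow_const
        fun _ => Or.inr hb.le
    apply Continuous.continuousOn
    fun_prop
  have hfd : ∀ θ ∈ Ico 0 (α * Real.pi / 2), f θ = ((Lam α β γ ω θ).im - y) *
      Real.sin (α * Real.pi / 2 - θ) ^ (β / α) := by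
    intro θ hθ
    have hd := Real.rpow_pos_of_pos (sin_sub_pos h hθ) (β / α)
    have hD := hd.ne'
    simp only [Lam_im, hf]
    generalize Real.sin (α * Real.pi / 2 - θ) ^ (β / α) = D at hD
    generalize Real.sin (γ * θ + (β - α * γ) * (Real.pi / 2)) = x
    field_simp
  have h0 : f 0 ≤ 0 := by
    rw [hfd 0 (left_mem_Ico.2 h.angle_pos), Lam_zero_im h, zero_sub, sub_zero]
    exact mul_nonpos_of_nonpos_of_nonneg (neg_nonpos.2 hy) (Real.rpow_nonneg hS.le _)
  have h1 : 0 < f (α * Real.pi / 2) := by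
    simp only [hf, sub_self, Real.sin_zero, Real.zero_rpow hb.ne', mul_zero, sub_zero]
    have hphase : γ * (α * Real.pi / 2) + (β - α * γ) * (Real.pi / 2) = β * (Real.pi / 2) := by
      ring
    have hβ := h.β_pos
    have : 0 < Real.sin (β * (Real.pi / 2)) :=
      Real.sin_pos_of_pos_of_lt_pi (by positivity) (by nlinarith [h.β_le])
    rw [hphase]
    positivity
  obtain ⟨θ, hθ, hθ0⟩ := intermediate_value_Icc h.angle_pos.le hcont ⟨h0, h1.le⟩
  have hne : θ ≠ α * Real.pi / 2 := by
    rintro rfl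
    exact h1.ne' hθ0
  have hθ' : θ ∈ Ico 0 (α * Real.pi / 2) := ⟨hθ.1, hθ.2.lt_of_ne hne⟩
  refine ⟨θ, hθ', ?_⟩
  rw [hfd θ hθ', mul_eq_zero] at hθ0
  rcases hθ0 with h2 | h2
  · exact sub_eq_zero.1 h2
  · exact absurd h2 (Real.rpow_pos_of_pos (sin_sub_pos h hθ') _).ne'

lemma exists_mem_curves_im_eq (h : Admissible α β γ ω) (y : ℝ) :
    ∃ z ∈ curve α β γ ω ∪ conjCurve α β γ ω, z.im = y := by
  rcases le_total 0 y with hy | hy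
  · obtain ⟨θ, hθ, hy'⟩ := exists_Lam_im_eq h hy
    exact ⟨_, Or.inl ⟨θ, hθ, rfl⟩, hy'⟩
  · obtain ⟨θ, hθ, hy'⟩ := exists_Lam_im_eq h (neg_nonneg.2 hy)
    exact ⟨conj (Lam α β γ ω θ), Or.inr ⟨θ, hθ, by simp⟩, by simp [hy']⟩

/-- A horizontal line meets the union of the two curves only once. -/
lemma eq_of_mem_curves (h : Admissible α β γ ω) {z w : ℂ}
    (hz : z ∈ curve α β γ ω ∪ conjCurve α β γ ω)
    (hw : w ∈ curve α β γ ω ∪ conjCurve α β γ ω) (him : z.im = w.im) : z = w := by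
  have hinj := (strictMonoOn_Lam_im h).injOn
  have h00 : (0 : ℝ) ∈ Ico 0 (α * Real.pi / 2) := left_mem_Ico.2 h.angle_pos
  -- a point of `Ψ` and a point of the conjugate curve are at the same height only at `Λ(0)`
  have hmix : ∀ z ∈ curve α β γ ω, ∀ w ∈ conjCurve α β γ ω, z.im = w.im → z = w := by
    rintro _ ⟨θ, hθ, rfl⟩ w ⟨φ, hφ, hw⟩ him
    have h1 := Lam_im_nonneg h hθ
    have h2 := Lam_im_nonneg h hφ
    have h3 : (Lam α β γ ω φ).im = -w.im := by rw [hw, Complex.conj_im]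
    have hθ0 : θ = 0 := hinj hθ h00 (by simp only [Lam_zero_im h]; linarith)
    have hφ0 : φ = 0 := hinj hφ h00 (by simp only [Lam_zero_im h]; linarith)
    subst hθ0 hφ0
    rw [← Complex.conj_conj w, ← hw, eq_comm, Complex.conj_eq_iff_im]
    exact Lam_zero_im h
  rcases hz with hz | hz <;> rcases hw with hw | hw
  · obtain ⟨θ, hθ, rfl⟩ := hz
    obtain ⟨φ, hφ, rfl⟩ := hw
    rw [hinj hθ hφ him]
  · exact hmix z hz w hw him
  · exact (hmix w hw z hz him.symm).symm
  · obtain ⟨θ, hθ, hz⟩ := hz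
    obtain ⟨φ, hφ, hw⟩ := hw
    have : θ = φ := hinj hθ hφ (by simp only [hz, hw, Complex.conj_im, him])
    rw [← Complex.conj_conj z, ← Complex.conj_conj w, ← hz, ← hw, this]

/-! ### The two regions -/

lemma stabilityRegion_eq : stabilityRegion α β γ ω = (charLHS α β γ ω '' {s | 0 ≤ s.re})ᶜ := by
  ext z
  simp [stabilityRegion]

lemma isOpen_stabilityRegion (h : Admissible α β γ ω) : IsOpen (stabilityRegion α β γ ω) := by
  rw [stabilityRegion_eq, isOpen_compl_iff, ← range_domRestrict]
  exact (isClosedEmbedding_charLHS h).isClosed_range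

lemma outerRegion_eq (h : Admissible α β γ ω) :
    outerRegion α β γ ω = charLHS α β γ ω '' {s | 0 < s.re} := by
  rw [outerRegion, ← image_axis_eq h, stabilityRegion_eq, compl_union, compl_compl]
  ext z
  constructor
  · rintro ⟨⟨s, hs, rfl⟩, hz⟩
    refine ⟨s, lt_of_le_of_ne hs fun h0 => hz ⟨s, h0.symm, rfl⟩, rfl⟩
  · rintro ⟨s, hs, rfl⟩
    have hs' : 0 < s.re := hs
    refine ⟨⟨s, hs'.le, rfl⟩, ?_⟩
    rintro ⟨t, ht, hts⟩
    have := charLHS_injOn h (ge_of_eq ht) hs'.le hts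
    subst this
    exact hs'.ne' ht

lemma isOpen_outerRegion (h : Admissible α β γ ω) : IsOpen (outerRegion α β γ ω) := by
  rw [outerRegion_eq h, isOpen_iff_mem_nhds]
  rintro _ ⟨s, hs, rfl⟩
  have hs0 : s ≠ 0 := by rintro rfl; simp at hs
  rw [← (analyticAt_charLHS h (le_of_lt hs) hs0).hasStrictDerivAt.map_nhds_eq
    (deriv_charLHS_ne_zero h (le_of_lt hs) hs0)]
  exact image_mem_map ((isOpen_lt continuous_const Complex.continuous_re).mem_nhds hs)

lemma isConnected_outerRegion (h : Admissible α β γ ω) : IsConnected (outerRegion α β γ ω) := by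
  rw [outerRegion_eq h]
  refine IsConnected.image ⟨⟨1, by simp⟩, (convex_halfSpace_re_gt 0).isPreconnected⟩ _
    ((continuousOn_charLHS h).mono fun s (hs : 0 < s.re) => hs.le)

lemma leftHalfPlane_subset (h : Admissible α β γ ω) :
    {z : ℂ | z.re < 0} ⊆ stabilityRegion α β γ ω := by
  rintro _ hz s hs rfl
  exact absurd (charLHS_re_nonneg h hs) (not_le.2 hz)

lemma disjoint_regions : Disjoint (stabilityRegion α β γ ω) (outerRegion α β γ ω) :=
  disjoint_compl_right.mono_left subset_union_left

lemma stabilityRegion_subset (h : Admissible α β γ ω) :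
    stabilityRegion α β γ ω ⊆ (curve α β γ ω ∪ conjCurve α β γ ω)ᶜ := by
  rw [stabilityRegion_eq, ← image_axis_eq h]
  exact compl_subset_compl.2 (image_mono fun s hs => ge_of_eq hs)

lemma compl_curves_subset : (curve α β γ ω ∪ conjCurve α β γ ω)ᶜ ⊆
    stabilityRegion α β γ ω ∪ outerRegion α β γ ω := by
  intro z hz
  by_cases hs : z ∈ stabilityRegion α β γ ω
  · exact Or.inl hs
  · exact Or.inr fun hc => hc.elim hs hz

/-- The union of the translates of the two curves by the real numbers in `J`. For `J = Iio 0` and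
`J = Ioi 0` this is the part of the plane to the left and to the right of the curves. -/
def horizontalShift (α β γ ω : ℝ) (J : Set ℝ) : Set ℂ :=
  (fun p : ℂ × ℝ => p.1 + (p.2 : ℂ)) '' ((curve α β γ ω ∪ conjCurve α β γ ω) ×ˢ J)

lemma isPreconnected_horizontalShift (h : Admissible α β γ ω) {J : Set ℝ}
    (hJ : IsPreconnected J) : IsPreconnected (horizontalShift α β γ ω J) := by
  refine IsPreconnected.image (IsPreconnected.prod ?_ hJ) _ (by fun_prop)
  rw [← image_axis_eq h]
  refine IsPreconnected.image ?_ _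
    ((continuousOn_charLHS h).mono fun s hs => ge_of_eq hs)
  exact ((convex_singleton (0 : ℝ)).linear_preimage Complex.reLm).isPreconnected

lemma horizontalShift_subset (h : Admissible α β γ ω) {J : Set ℝ} (hJ : (0 : ℝ) ∉ J) :
    horizontalShift α β γ ω J ⊆ (curve α β γ ω ∪ conjCurve α β γ ω)ᶜ := by
  rintro _ ⟨⟨z, x⟩, ⟨hz, hx⟩, rfl⟩ hzx
  have h1 := eq_of_mem_curves h hz hzx (by simp)
  have h2 : x = 0 := by simpa using h1
  exact hJ (h2 ▸ hx)

/-- The part of the plane to the left of the two curves is connected and contains points of the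
left half-plane, so it cannot leave the stability region. -/
lemma leftShift_subset (h : Admissible α β γ ω) :
    horizontalShift α β γ ω (Iio 0) ⊆ stabilityRegion α β γ ω := by
  refine (isPreconnected_horizontalShift h isPreconnected_Iio).subset_left_of_subset_union
    (isOpen_stabilityRegion h) (isOpen_outerRegion h) disjoint_regions
    ((horizontalShift_subset h (by simp)).trans compl_curves_subset) ?_
  obtain ⟨z, hz, -⟩ := exists_mem_curves_im_eq h 0
  refine ⟨z + ((-|z.re| - 1 : ℝ) : ℂ), ⟨(z, _), ⟨hz, ?_⟩, rfl⟩, leftHalfPlane_subset h ?_⟩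
  · simp only [mem_Iio]
    linarith [abs_nonneg z.re]
  · simp only [mem_ofPred_eq, Complex.add_re, Complex.ofReal_re]
    linarith [le_abs_self z.re]

lemma mem_shift_or (h : Admissible α β γ ω) {z : ℂ}
    (hz : z ∉ curve α β γ ω ∪ conjCurve α β γ ω) :
    z ∈ horizontalShift α β γ ω (Iio 0) ∨ z ∈ horizontalShift α β γ ω (Ioi 0) := by
  obtain ⟨c, hc, him⟩ := exists_mem_curves_im_eq h z.im
  have heq : c + ((z.re - c.re : ℝ) : ℂ) = z := by
    apply Complex.ext <;> simp [him]
  rcases lt_trichotomy (z.re - c.re) 0 with hlt | h0 | hgt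
  · exact Or.inl ⟨(c, _), ⟨hc, hlt⟩, heq⟩
  · rw [h0, Complex.ofReal_zero, add_zero] at heq
    exact absurd (heq ▸ hc) hz
  · exact Or.inr ⟨(c, _), ⟨hc, hgt⟩, heq⟩

lemma outerRegion_subset_rightShift (h : Admissible α β γ ω) :
    outerRegion α β γ ω ⊆ horizontalShift α β γ ω (Ioi 0) := by
  intro z hz
  refine (mem_shift_or h fun hc => hz (Or.inr hc)).resolve_left fun hl => ?_
  exact disjoint_left.1 disjoint_regions (leftShift_subset h hl) hz

lemma rightShift_subset (h : Admissible α β γ ω) :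
    horizontalShift α β γ ω (Ioi 0) ⊆ outerRegion α β γ ω := by
  refine (isPreconnected_horizontalShift h isPreconnected_Ioi).subset_left_of_subset_union
    (isOpen_outerRegion h) (isOpen_stabilityRegion h) disjoint_regions.symm
    (((horizontalShift_subset h (by simp)).trans compl_curves_subset).trans
      (union_comm _ _).subset) ?_
  obtain ⟨z, hz⟩ := (isConnected_outerRegion h).nonempty
  exact ⟨z, outerRegion_subset_rightShift h hz, hz⟩

/-- The stability region is the part of the plane to the left of the two curves. -/
lemma stabilityRegion_eq_leftShift (h : Admissible α β γ ω) :
    stabilityRegion α β γ ω = horizontalShift α β γ ω (Iio 0) := by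
  refine Subset.antisymm (fun z hz => ?_) (leftShift_subset h)
  refine (mem_shift_or h (stabilityRegion_subset h hz)).resolve_right fun hr => ?_
  exact disjoint_left.1 disjoint_regions hz (rightShift_subset h hr)

lemma isConnected_stabilityRegion (h : Admissible α β γ ω) :
    IsConnected (stabilityRegion α β γ ω) := by
  refine ⟨⟨-1, leftHalfPlane_subset h (by simp)⟩, ?_⟩
  rw [stabilityRegion_eq_leftShift h]
  exact isPreconnected_horizontalShift h isPreconnected_Iio

lemma mem_closure_horizontalShift {J : Set ℝ} (hJ : (0 : ℝ) ∈ closure J) {z : ℂ}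
    (hz : z ∈ curve α β γ ω ∪ conjCurve α β γ ω) :
    z ∈ closure (horizontalShift α β γ ω J) := by
  have hc : Continuous fun x : ℝ => z + (x : ℂ) := by fun_prop
  have h1 := image_closure_subset_closure_image hc (mem_image_of_mem _ hJ)
  rw [Complex.ofReal_zero, add_zero] at h1
  refine closure_mono ?_ h1
  rintro _ ⟨x, hx, rfl⟩
  exact ⟨(z, x), ⟨hz, hx⟩, rfl⟩

lemma frontier_eq_of_disjoint_of_union_eq {X : Type*} [TopologicalSpace X] {U V C : Set X}
    (hU : IsOpen U) (hV : IsOpen V) (hUV : Disjoint U V) (hcov : Cᶜ ⊆ U ∪ V) (hUC : U ⊆ Cᶜ)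
    (hC : C ⊆ closure U) : frontier U = C := by
  rw [hU.frontier_eq]
  refine Subset.antisymm ?_ fun x hx => ⟨hC hx, fun hxU => hUC hxU hx⟩
  rintro x ⟨hx, hxU⟩
  by_contra hxC
  exact disjoint_left.1 (hUV.closure_left hV) hx ((hcov hxC).resolve_left hxU)

lemma frontier_stabilityRegion (h : Admissible α β γ ω) :
    frontier (stabilityRegion α β γ ω) = curve α β γ ω ∪ conjCurve α β γ ω := by
  refine frontier_eq_of_disjoint_of_union_eq (isOpen_stabilityRegion h) (isOpen_outerRegion h)
    disjoint_regions compl_curves_subset (stabilityRegion_subset h) fun z hz => ?_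
  rw [stabilityRegion_eq_leftShift h]
  exact mem_closure_horizontalShift (by simp) hz

lemma frontier_outerRegion (h : Admissible α β γ ω) :
    frontier (outerRegion α β γ ω) = curve α β γ ω ∪ conjCurve α β γ ω := by
  refine frontier_eq_of_disjoint_of_union_eq (isOpen_outerRegion h) (isOpen_stabilityRegion h)
    disjoint_regions.symm (compl_curves_subset.trans (union_comm _ _).subset)
    (compl_subset_compl.2 subset_union_right) fun z hz => ?_
  exact closure_mono (rightShift_subset h) (mem_closure_horizontalShift (by simp) hz)

lemma stabilityRegion_eq_connectedComponentIn (h : Admissible α β γ ω) {z : ℂ}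
    (hz : z ∈ stabilityRegion α β γ ω) : stabilityRegion α β γ ω =
      connectedComponentIn (curve α β γ ω ∪ conjCurve α β γ ω)ᶜ z := by
  have hsub := stabilityRegion_subset h
  refine Subset.antisymm ?_ ?_
  · exact (isConnected_stabilityRegion h).isPreconnected.subset_connectedComponentIn hz hsub
  · exact isPreconnected_connectedComponentIn.subset_left_of_subset_union
      (isOpen_stabilityRegion h) (isOpen_outerRegion h) disjoint_regions
      ((connectedComponentIn_subset _ _).trans compl_curves_subset)
      ⟨z, mem_connectedComponentIn (hsub hz), hz⟩

/-! ### Transversality -/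

/-- For `z` near `charLHS α β γ ω s₀`, all roots in the closed right half-plane are near `s₀`. -/
lemma eventually_root_mem (h : Admissible α β γ ω) {s₀ : ℂ} (hs₀ : 0 ≤ s₀.re) {U : Set ℂ}
    (hU : U ∈ 𝓝 s₀) :
    ∀ᶠ z in 𝓝 (charLHS α β γ ω s₀), ∀ s : ℂ, 0 ≤ s.re → charLHS α β γ ω s = z → s ∈ U := by
  have h1 : (Subtype.val ⁻¹' U : Set {s : ℂ | 0 ≤ s.re}) ∈ 𝓝 ⟨s₀, hs₀⟩ :=
    continuous_subtype_val.continuousAt.preimage_mem_nhds hU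
  rw [(isClosedEmbedding_charLHS h).isInducing.nhds_eq_comap, mem_comap] at h1
  obtain ⟨V, hV, hVU⟩ := h1
  filter_upwards [hV] with z hz s hs hsz
  exact hVU (show (⟨s, hs⟩ : {s : ℂ | 0 ≤ s.re}) ∈ _ from by simpa [hsz] using hz)

/-- The gradient of the real part of a holomorphic function is the conjugate of its derivative. -/
lemma hasGradientAt_re {f : ℂ → ℂ} {d z : ℂ} (hf : HasDerivAt f d z) :
    HasGradientAt (fun z => (f z).re) (conj d) z := by
  rw [hasGradientAt_iff_hasFDerivAt]
  have h1 := Complex.reCLM.hasFDerivAt.comp z (hf.hasFDerivAt.restrictScalars ℝ)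
  refine h1.congr_fderiv ?_
  ext
  simp [Complex.inner]

/-- Transversality at the image of a point `τ * I ≠ 0` of the imaginary axis, where `F` has nonzero
derivative. The normal direction is `F'(τ * I)`, since the local inverse has derivative
`1 / F'(τ * I)` and the conjugate of this is a positive multiple of `F'(τ * I)`. -/
lemma transversalAt_of_axis (h : Admissible α β γ ω) {τ k : ℝ} (hτ : τ ≠ 0) (hk : 0 < k) :
    TransversalAt α β γ ω (charLHS α β γ ω (τ * Complex.I))
      (k * deriv (charLHS α β γ ω) (τ * Complex.I)) := by
  set F := charLHS α β γ ω with hF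
  set s₀ : ℂ := τ * Complex.I with hs₀
  have hre : s₀.re = 0 := by simp [hs₀]
  have hne : s₀ ≠ 0 := mul_ne_zero (by exact_mod_cast hτ) Complex.I_ne_zero
  have han : AnalyticAt ℂ F s₀ := analyticAt_charLHS h hre.ge hne
  have hd : deriv F s₀ ≠ 0 := deriv_charLHS_ne_zero h hre.ge hne
  set s := han.hasStrictDerivAt.localInverse F (deriv F s₀) s₀ hd with hs
  have hsan : AnalyticAt ℂ s (F s₀) := han.analyticAt_localInverse hd
  have hss : s (F s₀) = s₀ := HasStrictFDerivAt.localInverse_apply_image ..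
  have hleft : ∀ᶠ x in 𝓝 s₀, s (F x) = x := han.hasStrictDerivAt.eventually_left_inverse hd
  have hright : ∀ᶠ z in 𝓝 (F s₀), F (s z) = z := han.hasStrictDerivAt.eventually_right_inverse hd
  have hder : HasDerivAt s (deriv F s₀)⁻¹ (F s₀) :=
    (han.hasStrictDerivAt.to_localInverse hd).hasDerivAt
  refine ⟨s₀, fun x => ⟨fun hx => ?_, fun hx => by rw [hx]; exact ⟨hre, rfl⟩⟩,
    s, hss, hsan, ?_, ?_, ?_⟩
  · exact charLHS_injOn h hx.1.ge hre.ge hx.2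
  · have h1 := (continuous_fst.tendsto (F s₀, s₀)).eventually hright
    have h2 := (continuous_snd.tendsto (F s₀, s₀)).eventually hleft
    filter_upwards [h1, h2] with p hp1 hp2
    constructor
    · intro hp
      rw [← hp, hp2]
    · intro hp
      rw [hp]
      exact hp1
  · refine ⟨(k * Complex.normSq (deriv F s₀))⁻¹,
      inv_pos.2 (mul_pos hk (Complex.normSq_pos.2 hd)), ?_⟩
    convert hasGradientAt_re hder using 1
    have hk0 : (k : ℂ) ≠ 0 := by exact_mod_cast hk.ne'
    have hcd : conj (deriv F s₀) ≠ 0 := (map_ne_zero _).2 hd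
    rw [map_inv₀]
    push_cast
    rw [Complex.normSq_eq_conj_mul_self]
    field_simp
  · filter_upwards [hright, eventually_root_mem h hre.ge hleft] with z hz hroot
    -- `s z` is the only possible root in the closed right half-plane
    have huniq : ∀ x : ℂ, 0 ≤ x.re → F x = z → x = s z := by
      intro x hx hxz
      have : s (F x) = x := hroot x hx hxz
      rw [← this, hxz]
    rw [outerRegion_eq h]
    refine ⟨⟨fun hzS => ?_, fun hneg x hx hxz => ?_⟩, ?_, fun hpos => ⟨s z, hpos, hz⟩⟩
    · by_contra! hcon
      exact hzS (s z) hcon hz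
    · rw [← huniq x hx hxz] at hneg
      exact absurd hx (not_le.2 hneg)
    · rintro ⟨x, hx, hxz⟩
      rwa [← huniq x (le_of_lt hx) hxz]

/-- The point `axisHeight α ω θ * I` moves upwards with nonzero speed. -/
lemma exists_hasDerivAt_axisHeight (h : Admissible α β γ ω)
    (hθ : θ ∈ Ioo 0 (α * Real.pi / 2)) :
    ∃ k : ℝ, 0 < k ∧ HasDerivAt (axisHeight α ω) k θ := by
  have hd := sin_sub_pos h (Ioo_subset_Ico_self hθ)
  have hs := sin_pos_of_mem h hθ
  have hw := neg_pos.2 h.ω_neg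
  have hα := h.α_pos
  have h1 : HasDerivAt (fun θ => Real.sin (α * Real.pi / 2 - θ))
      (-Real.cos (α * Real.pi / 2 - θ)) θ := by
    simpa using ((hasDerivAt_id θ).const_sub (α * Real.pi / 2)).sin
  have h2 := (((Real.hasDerivAt_sin θ).div h1 hd.ne').const_mul (-ω)).rpow_const
    (p := 1 / α) (Or.inl (mul_pos hw (div_pos hs hd)).ne')
  have h0 : 0 < -ω * (Real.sin θ / Real.sin (α * Real.pi / 2 - θ)) := by positivity
  refine ⟨_, ?_, h2⟩
  have h3 : Real.cos θ * Real.sin (α * Real.pi / 2 - θ) -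
      Real.sin θ * -Real.cos (α * Real.pi / 2 - θ) = Real.sin (α * Real.pi / 2) := by
    have := Real.sin_add θ (α * Real.pi / 2 - θ)
    rw [add_sub_cancel] at this
    rw [this]
    ring
  have h4 := sin_angle_pos h
  rw [h3]
  exact mul_pos (mul_pos (mul_pos hw (by positivity)) (by positivity)) (Real.rpow_pos_of_pos h0 _)

lemma transversal_Lam (h : Admissible α β γ ω) (hθ : θ ∈ Ioo 0 (α * Real.pi / 2)) :
    ∃ v : ℂ, v ≠ 0 ∧ HasDerivAt (Lam α β γ ω) v θ ∧
      TransversalAt α β γ ω (Lam α β γ ω θ) (-Complex.I * v) ∧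
      TransversalAt α β γ ω (conj (Lam α β γ ω θ)) (Complex.I * conj v) := by
  obtain ⟨k, hk, hder⟩ := exists_hasDerivAt_axisHeight h hθ
  have ht := axisHeight_pos h hθ
  set s₀ : ℂ := axisHeight α ω θ * Complex.I with hs₀
  have hre : s₀.re = 0 := by simp [hs₀]
  have hne : s₀ ≠ 0 := mul_ne_zero (by exact_mod_cast ht.ne') Complex.I_ne_zero
  have hconj : conj s₀ = ((-axisHeight α ω θ : ℝ) : ℂ) * Complex.I := by simp [hs₀]
  have hLam : Lam α β γ ω θ = charLHS α β γ ω s₀ :=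
    (charLHS_axisHeight h (Ioo_subset_Ico_self hθ)).symm
  have hF := (analyticAt_charLHS h hre.ge hne).differentiableAt.hasDerivAt
  have hd := deriv_charLHS_ne_zero h hre.ge hne
  refine ⟨deriv (charLHS α β γ ω) s₀ * (k * Complex.I), ?_, ?_, ?_, ?_⟩
  · exact mul_ne_zero hd (mul_ne_zero (by exact_mod_cast hk.ne') Complex.I_ne_zero)
  · have h1 : HasDerivAt (fun θ => charLHS α β γ ω (axisHeight α ω θ * Complex.I))
        (deriv (charLHS α β γ ω) s₀ * (k * Complex.I)) θ :=
      hF.comp_of_eq θ (hder.ofReal_comp.mul_const Complex.I) rfl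
    refine h1.congr_of_eventuallyEq ?_
    filter_upwards [isOpen_Ioo.mem_nhds hθ] with φ hφ
    exact (charLHS_axisHeight h (Ioo_subset_Ico_self hφ)).symm
  · convert transversalAt_of_axis h ht.ne' hk using 1
    linear_combination (-deriv (charLHS α β γ ω) s₀ * k) * Complex.I_sq
  · rw [hLam, ← charLHS_conj_of_re_nonneg h hre.ge, hconj]
    convert transversalAt_of_axis h (neg_ne_zero.2 ht.ne') hk using 1
    rw [← hconj, deriv_charLHS_conj h hre.ge hne]
    simp only [map_mul, Complex.conj_ofReal, Complex.conj_I]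
    linear_combination (-conj (deriv (charLHS α β γ ω) s₀) * k) * Complex.I_sq

end Prabhakar

theorem mainTheorem1 (α β γ ω : ℝ) (hω : ω < 0) (hα : 0 < α) (hα1 : α ≤ 1)
    (hαγ : 0 < α * γ) (hαγβ : α * γ ≤ β) (hβ : β ≤ 1) :
    -- the stability region is an open connected set containing the open left half-plane, whose
    -- boundary consists of the two curves
    (IsOpen (Prabhakar.stabilityRegion α β γ ω) ∧
      IsConnected (Prabhakar.stabilityRegion α β γ ω) ∧
      {z : ℂ | z.re < 0} ⊆ Prabhakar.stabilityRegion α β γ ω ∧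
      frontier (Prabhakar.stabilityRegion α β γ ω) =
        Prabhakar.curve α β γ ω ∪ Prabhakar.conjCurve α β γ ω) ∧
    -- it is the connected component of the complement of the curves containing that half-plane
    (∀ z : ℂ, z.re < 0 → Prabhakar.stabilityRegion α β γ ω =
      connectedComponentIn (Prabhakar.curve α β γ ω ∪ Prabhakar.conjCurve α β γ ω)ᶜ z) ∧
    -- the rest of the complement of the curves is a single region with the same boundary, and
    -- there the characteristic equation has a root with positive real part
    (IsOpen (Prabhakar.outerRegion α β γ ω) ∧
      IsConnected (Prabhakar.outerRegion α β γ ω) ∧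
      frontier (Prabhakar.outerRegion α β γ ω) =
        Prabhakar.curve α β γ ω ∪ Prabhakar.conjCurve α β γ ω ∧
      ∀ z ∈ Prabhakar.outerRegion α β γ ω,
        ∃ s : ℂ, 0 < s.re ∧ Prabhakar.charLHS α β γ ω s = z) ∧
    -- transversality along both curves (away from the initial point), the normal being the right
    -- normal of the first curve and the left normal of its conjugate
    (∀ θ ∈ Set.Ioo 0 (α * Real.pi / 2), ∃ v : ℂ, v ≠ 0 ∧
      HasDerivAt (Prabhakar.Lam α β γ ω) v θ ∧
      Prabhakar.TransversalAt α β γ ω (Prabhakar.Lam α β γ ω θ) (-Complex.I * v) ∧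
      Prabhakar.TransversalAt α β γ ω (starRingEnd ℂ (Prabhakar.Lam α β γ ω θ))
        (Complex.I * starRingEnd ℂ v)) := by
  have h : Prabhakar.Admissible α β γ ω :=
    ⟨hω, hα, hα1, pos_of_mul_pos_right hαγ hα.le, hαγβ, hβ⟩
  refine ⟨⟨Prabhakar.isOpen_stabilityRegion h, Prabhakar.isConnected_stabilityRegion h,
    Prabhakar.leftHalfPlane_subset h, Prabhakar.frontier_stabilityRegion h⟩,
    fun z hz => Prabhakar.stabilityRegion_eq_connectedComponentIn h
      (Prabhakar.leftHalfPlane_subset h hz),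
    ⟨Prabhakar.isOpen_outerRegion h, Prabhakar.isConnected_outerRegion h,
      Prabhakar.frontier_outerRegion h, fun z hz => ?_⟩,
    fun θ hθ => Prabhakar.transversal_Lam h hθ⟩
  rw [Prabhakar.outerRegion_eq h] at hz
  exact hz
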